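/- Let $K$ be an arbitrary field, let $n \ge 0$ be an integer, and let $A_n(K)$ be the space of all $n \times n$ alternating matrices over $K$, that is, of all matrices $M$ such that $X^T M X = 0$ for every $X \in K^n$. Let $F : A_n(K) \to K^n$ be a $K$-linear map that is range-compatible, i.e. for every $M \in A_n(K)$ the vector $F(M)$ belongs to the range $\{MX : X \in K^n\}$ of $M$. Then $F$ is local, i.e. there exists $x \in K^n$ such that $F(M) = Mx$ for all $M \in A_n(K)$. -/

import Mathlib

/-- The linear subspace of all alternating `n × n` matrices over `K`, i.e. of those matrices `M`
with `Xᵀ M X = 0` for every column vector `X`. -/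
def alternatingMatrices (K : Type*) [Field K] (n : ℕ) :
    Submodule K (Matrix (Fin n) (Fin n) K) where
  carrier := {M | ∀ X : Fin n → K, X ⬝ᵥ M.mulVec X = 0}
  add_mem' := by
    intro A B hA hB X
    rw [Matrix.add_mulVec, dotProduct_add, hA X, hB X, add_zero]
  zero_mem' := by
    intro X
    rw [Matrix.zero_mulVec, dotProduct_zero]
  smul_mem' := by
    intro c A hA X
    rw [Matrix.smul_mulVec, dotProduct_smul, hA X, smul_zero]

/-- The space of alternating matrices regarded as a space of operators on `Kⁿ`, through the
canonical basis: the matrix `M` is identified with `X ↦ M X`. -/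
def alternatingOperators (K : Type*) [Field K] (n : ℕ) :
    Submodule K ((Fin n → K) →ₗ[K] (Fin n → K)) :=
  (alternatingMatrices K n).map (Matrix.toLin' (R := K) (m := Fin n) (n := Fin n)).toLinearMap

/-- A map `F` on a set `S` of linear operators from `U` to `V`, with values in `V`, is
range-compatible when `F s` belongs to the range of `s` for every `s ∈ S`. -/
def IsRangeCompatible {K U V : Type*} [Field K] [AddCommGroup U] [Module K U]
    [AddCommGroup V] [Module K V] (S : Set (U →ₗ[K] V)) (F : S → V) : Prop :=
  ∀ s : S, F s ∈ LinearMap.range (s : U →ₗ[K] V)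

/-- A map `F` on a set `S` of linear operators from `U` to `V`, with values in `V`, is local when
it is the evaluation at some fixed vector `x` of `U`. -/
def IsLocalMap {K U V : Type*} [Field K] [AddCommGroup U] [Module K U]
    [AddCommGroup V] [Module K V] (S : Set (U →ₗ[K] V)) (F : S → V) : Prop :=
  ∃ x : U, ∀ s : S, F s = (s : U →ₗ[K] V) x

section AlternatingMatrices

variable {K : Type*} [Field K] {n : ℕ}

/-! The matrices `E_ij - E_ji` span, so it suffices to find `x` on them. Range-compatibility enters
only through rows: a zero row of `M` forces a zero entry of `G M`, and equal rows force equal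
entries. The first confines `G (E_ij - E_ji)` to coordinates `i` and `j`; the second makes its
`i`-th entry depend on `j` alone, and this value is `x j`. -/

theorem alternatingMatrices_apply_self {M : Matrix (Fin n) (Fin n) K}
    (hM : M ∈ alternatingMatrices K n) (i : Fin n) : M i i = 0 := by
  have h := hM (Pi.single i 1)
  simpa using h

theorem alternatingMatrices_apply_swap {M : Matrix (Fin n) (Fin n) K}
    (hM : M ∈ alternatingMatrices K n) (i j : Fin n) : M j i = -M i j := by
  have h := hM (Pi.single i 1 + Pi.single j 1)
  simp only [Matrix.mulVec_add, dotProduct_add, add_dotProduct, Matrix.mulVec_single_one,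
    single_one_dotProduct, Matrix.col_apply, alternatingMatrices_apply_self hM] at h
  linear_combination h

variable (K) in
/-- The elementary alternating matrix with entry `1` at `(i, j)` and `-1` at `(j, i)`
(zero when `i = j`). -/
def alternatingSingle (i j : Fin n) : alternatingMatrices K n :=
  ⟨Matrix.single i j 1 - Matrix.single j i 1, fun X => by
    simp [Matrix.sub_mulVec, Matrix.single_mulVec, dotProduct, mul_sub,
      Function.update_apply, mul_comm]⟩

theorem coe_alternatingSingle (i j : Fin n) :
    (alternatingSingle K i j : Matrix (Fin n) (Fin n) K) =
      Matrix.single i j 1 - Matrix.single j i 1 := rfl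

theorem alternatingSingle_swap (i j : Fin n) :
    alternatingSingle K j i = -alternatingSingle K i j := by
  apply Subtype.ext
  simp [coe_alternatingSingle]

theorem alternatingSingle_self (i : Fin n) : alternatingSingle K i i = 0 := by
  apply Subtype.ext
  simp [coe_alternatingSingle]

theorem eq_sum_alternatingSingle (M : alternatingMatrices K n) :
    M = ∑ i, ∑ j, (if i < j then M.1 i j else 0) • alternatingSingle K i j := by
  apply Subtype.ext
  ext a b
  simp only [Submodule.coe_sum, Submodule.coe_smul, coe_alternatingSingle, Matrix.sum_apply,
    Matrix.smul_apply, Matrix.sub_apply, smul_eq_mul, mul_sub, Finset.sum_sub_distrib,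
    Matrix.single_apply, ite_and, mul_ite, mul_one, mul_zero, Finset.sum_ite_irrel,
    Finset.sum_ite_eq', Finset.sum_const_zero, Finset.mem_univ, if_true]
  rcases lt_trichotomy a b with h | h | h
  · simp [h, h.not_gt]
  · simp [h, alternatingMatrices_apply_self M.2]
  · simp [h, h.not_gt, alternatingMatrices_apply_swap M.2 b a]

section RangeCompatible

variable {G : alternatingMatrices K n →ₗ[K] (Fin n → K)}

theorem apply_eq_zero_of_row_eq_zero (hG : ∀ M, ∃ X, G M = M.1.mulVec X)
    (M : alternatingMatrices K n) {i : Fin n} (h : M.1 i = 0) : G M i = 0 := by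
  obtain ⟨X, hX⟩ := hG M
  rw [hX, Matrix.mulVec, h, zero_dotProduct]

theorem apply_eq_of_row_eq (hG : ∀ M, ∃ X, G M = M.1.mulVec X)
    (M : alternatingMatrices K n) {i k : Fin n} (h : M.1 i = M.1 k) : G M i = G M k := by
  obtain ⟨X, hX⟩ := hG M
  rw [hX, Matrix.mulVec, Matrix.mulVec, h]

theorem apply_alternatingSingle_of_ne (hG : ∀ M, ∃ X, G M = M.1.mulVec X)
    {i j k : Fin n} (hi : k ≠ i) (hj : k ≠ j) : G (alternatingSingle K i j) k = 0 := by
  apply apply_eq_zero_of_row_eq_zero hG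
  ext l
  simp [coe_alternatingSingle, hi.symm, hj.symm]

/-- For `i ≠ k`, rows `i` and `k` of the sum of the two matrices both equal the `j`-th unit vector.
-/
theorem apply_alternatingSingle_left_eq (hG : ∀ M, ∃ X, G M = M.1.mulVec X)
    {i j k : Fin n} (hi : i ≠ j) (hk : k ≠ j) :
    G (alternatingSingle K i j) i = G (alternatingSingle K k j) k := by
  rcases eq_or_ne i k with rfl | hik
  · rfl
  have h := apply_eq_of_row_eq hG (alternatingSingle K i j + alternatingSingle K k j)
    (i := i) (k := k) (by
      ext l
      simp [coe_alternatingSingle, Matrix.single_apply, hi.symm, hk.symm, hik, hik.symm])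
  simpa [apply_alternatingSingle_of_ne hG hik hi,
    apply_alternatingSingle_of_ne hG hik.symm hk] using h

theorem exists_apply_alternatingSingle_left (hG : ∀ M, ∃ X, G M = M.1.mulVec X) (j : Fin n) :
    ∃ c : K, ∀ i, i ≠ j → G (alternatingSingle K i j) i = c := by
  by_cases h : ∃ k, k ≠ j
  · obtain ⟨k, hk⟩ := h
    exact ⟨_, fun i hi => apply_alternatingSingle_left_eq hG hi hk⟩
  -- Here `j` is the only index, so any constant would do.
  · exact ⟨0, fun i hi => (h ⟨i, hi⟩).elim⟩

theorem exists_eq_mulVec_of_rangeCompatible (hG : ∀ M, ∃ X, G M = M.1.mulVec X) :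
    ∃ x : Fin n → K, ∀ M, G M = M.1.mulVec x := by
  choose x hx using exists_apply_alternatingSingle_left hG
  have hsingle : ∀ i j, G (alternatingSingle K i j) =
      (alternatingSingle K i j).1.mulVec x := by
    intro i j
    rcases eq_or_ne i j with rfl | hij
    · simp [alternatingSingle_self]
    ext k
    have hmul : (alternatingSingle K i j).1.mulVec x k =
        (if k = i then x j else 0) - (if k = j then x i else 0) := by
      simp [coe_alternatingSingle, Matrix.sub_mulVec, Matrix.single_mulVec,
        Function.update_apply]
    rw [hmul]
    rcases eq_or_ne k i with rfl | hki
    · simp [hij, hx j k hij]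
    rcases eq_or_ne k j with rfl | hkj
    -- Antisymmetry reduces the second coordinate to the first, giving `-x i`.
    · have hneg : G (alternatingSingle K i k) k = -G (alternatingSingle K k i) k := by
        rw [alternatingSingle_swap k i, map_neg, Pi.neg_apply]
      simp [hki, hneg, hx i k hki]
    · simp [hki, hkj, apply_alternatingSingle_of_ne hG hki hkj]
  refine ⟨x, fun M => ?_⟩
  -- With `M ↦ M x` as a linear map, both sides expand along the spanning family.
  obtain ⟨L, hL⟩ : ∃ L : alternatingMatrices K n →ₗ[K] (Fin n → K), ∀ N, L N = N.1.mulVec x :=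
    ⟨(Matrix.mulVecBilin K K).flip x ∘ₗ (alternatingMatrices K n).subtype, fun _ => rfl⟩
  rw [← hL, eq_sum_alternatingSingle M]
  simp only [map_sum, map_smul, hsingle, ← hL]

end RangeCompatible

end AlternatingMatrices

theorem mainTheorem6 (K : Type*) [Field K] (n : ℕ)
    (F : alternatingOperators K n →ₗ[K] (Fin n → K))
    (hF : IsRangeCompatible (alternatingOperators K n : Set ((Fin n → K) →ₗ[K] (Fin n → K))) F) :
    IsLocalMap (alternatingOperators K n : Set ((Fin n → K) →ₗ[K] (Fin n → K))) F := by
  let e : alternatingMatrices K n →ₗ[K] alternatingOperators K n :=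
    Matrix.toLin'.toLinearMap.submoduleMap (alternatingMatrices K n)
  have hG : ∀ M, ∃ X, (F ∘ₗ e) M = M.1.mulVec X := fun M => by
    obtain ⟨X, hX⟩ := hF (e M)
    exact ⟨X, hX.symm⟩
  obtain ⟨x, hx⟩ := exists_eq_mulVec_of_rangeCompatible hG
  refine ⟨x, ?_⟩
  rintro ⟨_, M, hM, rfl⟩
  exact hx ⟨M, hM⟩
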